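/- Let $K$ be a field and let $L$ be a finite lattice. Let $K[L]$ be the polynomial ring over $K$ whose variables are the elements of $L$, let $I_L\subseteq K[L]$ be the ideal generated by all binomials $ab-(a\vee b)(a\wedge b)$ with $a,b\in L$ incomparable, and let $R=H[L]:=K[L]/I_L$, graded by $\deg a=1$ for every $a\in L$. An ideal of $R$ is called a poset ideal if it is generated by the residue classes $\overline{a}$, $a\in J$, of the elements of some (possibly empty) subset $J\subseteq L$ such that $a\le b$ and $b\in J$ imply $a\in J$. A collection $\mathcal F$ of ideals of $R$ is called a Koszul filtration of $R$ if (i) every ideal in $\mathcal F$ is generated by linear forms (homogeneous elements of degree $1$); (ii) the zero ideal and the maximal graded ideal $\mathfrak m$ of $R$ (generated by all homogeneous elements of positive degree) belong to $\mathcal F$; (iii) for every nonzero $I\in\mathcal F$ there is $J\in\mathcal F$ with $J\subsetneq I$ such that the $R$-module $I/J$ is cyclic and $J:I=\{r\in R : rI\subseteq J\}$ belongs to $\mathcal F$. Then the following statements are equivalent: (1) $L$ is distributive, i.e. $x\wedge(y\vee z)=(x\wedge y)\vee(x\wedge z)$ and $x\vee(y\wedge z)=(x\vee y)\wedge(x\vee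 z)$ for all $x,y,z\in L$; (2) the collection of all poset ideals of $R$ is a Koszul filtration of $R$; (3) $R$ admits a Koszul filtration in which every ideal is a poset ideal. -/

import Mathlib

namespace JoinMeet

/-- A lattice is distributive if both distributive laws hold in it. -/
def IsDistributive (L : Type*) [Lattice L] : Prop :=
  ∀ x y z : L, x ⊓ (y ⊔ z) = (x ⊓ y) ⊔ (x ⊓ z) ∧ x ⊔ (y ⊓ z) = (x ⊔ y) ⊓ (x ⊔ z)

section KoszulFiltration

variable {K R : Type*} [Field K] [CommRing R] [Algebra K R]

/-- A collection `F` of ideals of a standard graded `K`-algebra `R`, with graded components `𝒜 n`,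
is a Koszul filtration. The linear forms are the elements of `𝒜 1`, and the maximal graded ideal
is the ideal generated by all homogeneous elements of positive degree. The `R`-module `I / J` is
the image of `I` in `R / J`, and `J.colon I` is the colon ideal `J : I = {r | r I ⊆ J}`. -/
structure IsKoszulFiltration (𝒜 : ℕ → Submodule K R) [GradedAlgebra 𝒜]
    (F : Set (Ideal R)) : Prop where
  generated_by_linear_forms : ∀ I ∈ F, ∃ S : Set R, S ⊆ 𝒜 1 ∧ I = Ideal.span S
  bot_mem : ⊥ ∈ F
  maximal_mem : (HomogeneousIdeal.irrelevant 𝒜).toIdeal ∈ F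
  exists_cyclic_step : ∀ I ∈ F, I ≠ ⊥ →
    ∃ J ∈ F, J < I ∧ (Submodule.map (Submodule.mkQ J) I).IsPrincipal ∧
      J.colon (I : Set R) ∈ F

end KoszulFiltration

section JoinMeetAlgebra

variable (K L : Type*) [Field K] [Lattice L]

open MvPolynomial

/-- The join-meet ideal of `K[L]`, generated by the basic binomials
`ab - (a ⊔ b)(a ⊓ b)` with `a`, `b` incomparable. -/
noncomputable def joinMeetIdeal : Ideal (MvPolynomial L K) :=
  Ideal.span {p | ∃ a b : L, ¬ a ≤ b ∧ ¬ b ≤ a ∧ p = X a * X b - X (a ⊔ b) * X (a ⊓ b)}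

/-- The `K`-algebra `H[L] = K[L] / I_L`. -/
abbrev JoinMeetAlgebra : Type _ := MvPolynomial L K ⧸ joinMeetIdeal K L

variable {L} in
/-- The residue class in `H[L]` of the variable `a`. -/
noncomputable def residue (a : L) : JoinMeetAlgebra K L :=
  Ideal.Quotient.mk (joinMeetIdeal K L) (X a)

/-- The standard grading of `H[L]`, in which every residue class of a variable has degree `1`:
the component of degree `n` consists of the classes of homogeneous polynomials of degree `n`. -/
noncomputable def grading (n : ℕ) : Submodule K (JoinMeetAlgebra K L) :=
  (homogeneousSubmodule L K n).map (Ideal.Quotient.mkₐ K (joinMeetIdeal K L)).toLinearMap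

theorem mk_mem_grading {n : ℕ} {p : MvPolynomial L K} (hp : p.IsHomogeneous n) :
    Ideal.Quotient.mk (joinMeetIdeal K L) p ∈ grading K L n :=
  ⟨p, hp, rfl⟩

instance grading_gradedMonoid : SetLike.GradedMonoid (grading K L) where
  one_mem := mk_mem_grading K L (isHomogeneous_one L K)
  mul_mem := by
    rintro i j _ _ ⟨p, hp, rfl⟩ ⟨q, hq, rfl⟩
    exact mk_mem_grading K L (IsHomogeneous.mul hp hq)

/-- The residue class of a variable, as an element of the component of degree `1`. -/
noncomputable def linearResidue (a : L) : grading K L 1 :=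
  ⟨residue K a, mk_mem_grading K L (isHomogeneous_X K a)⟩

/-- The homomorphism from `H[L]` that splits an element into its homogeneous components. -/
noncomputable def decomposition :
    JoinMeetAlgebra K L →ₐ[K] DirectSum ℕ (fun n => grading K L n) :=
  Ideal.Quotient.liftₐ (joinMeetIdeal K L)
    (aeval fun a => DirectSum.of (fun n => grading K L n) 1 (linearResidue K L a)) (by
      intro p hp
      change p ∈ RingHom.ker _
      refine (Ideal.span_le.2 ?_ : joinMeetIdeal K L ≤ _) hp
      rintro _ ⟨a, b, hab, hba, rfl⟩
      simp only [SetLike.mem_coe, RingHom.mem_ker, map_sub, map_mul, aeval_X,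
        DirectSum.of_mul_of, sub_eq_zero]
      congr 1
      apply Subtype.ext
      change residue K a * residue K b = residue K (a ⊔ b) * residue K (a ⊓ b)
      simp only [residue, ← map_mul]
      exact Ideal.Quotient.eq.2 (Ideal.subset_span ⟨a, b, hab, hba, rfl⟩))

theorem decomposition_residue (a : L) :
    decomposition K L (residue K a) =
      DirectSum.of (fun n => grading K L n) 1 (linearResidue K L a) :=
  aeval_X _ a

theorem decomposition_monomial (s : L →₀ ℕ) :
    ∃ h, decomposition K L (Ideal.Quotient.mk _ (monomial s 1)) =
      DirectSum.of (fun n => grading K L n) s.degree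
        ⟨Ideal.Quotient.mk _ (monomial s 1), h⟩ := by
  have hmul : ∀ (m n : ℕ) (x y : JoinMeetAlgebra K L),
      (∃ h, decomposition K L x = DirectSum.of (fun n => grading K L n) m ⟨x, h⟩) →
      (∃ h, decomposition K L y = DirectSum.of (fun n => grading K L n) n ⟨y, h⟩) →
      ∃ h, decomposition K L (x * y) =
        DirectSum.of (fun n => grading K L n) (m + n) ⟨x * y, h⟩ := by
    rintro m n x y ⟨hx, ex⟩ ⟨hy, ey⟩
    refine ⟨SetLike.mul_mem_graded hx hy, ?_⟩
    rw [map_mul, ex, ey, DirectSum.of_mul_of]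
    rfl
  have hone : ∃ h, decomposition K L 1 =
      DirectSum.of (fun n => grading K L n) 0 ⟨1, h⟩ :=
    ⟨SetLike.GradedOne.one_mem, map_one _⟩
  induction s using Finsupp.induction_linear with
  | zero =>
    rw [show Finsupp.degree (0 : L →₀ ℕ) = 0 from map_zero _]
    exact hone
  | add s t hs ht =>
    have h := hmul _ _ _ _ hs ht
    rwa [← map_mul, monomial_mul, one_mul, ← map_add] at h
  | single a k =>
    rw [Finsupp.degree_single]
    induction k with
    | zero => simpa using hone
    | succ k ih =>
      have h := hmul _ 1 _ (residue K a) ih ⟨_, decomposition_residue K L a⟩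
      rwa [residue, X, ← map_mul, monomial_mul, one_mul, ← Finsupp.single_add] at h

theorem decomposition_mk {n : ℕ} {p : MvPolynomial L K} (hp : p.IsHomogeneous n) :
    decomposition K L (Ideal.Quotient.mk _ p) =
      DirectSum.of (fun n => grading K L n) n
        ⟨Ideal.Quotient.mk _ p, mk_mem_grading K L hp⟩ := by
  have key : ∃ h, decomposition K L (Ideal.Quotient.mk _ p) =
      DirectSum.of (fun n => grading K L n) n ⟨Ideal.Quotient.mk _ p, h⟩ := by
    rw [p.as_sum, map_sum]
    refine Finset.sum_induction _
      (fun x => ∃ h, decomposition K L x = DirectSum.of (fun n => grading K L n) n ⟨x, h⟩)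
      ?_ ⟨zero_mem _, ?_⟩ ?_
    · rintro x y ⟨hx, ex⟩ ⟨hy, ey⟩
      refine ⟨add_mem hx hy, ?_⟩
      rw [map_add, ex, ey, ← map_add]
      rfl
    · rw [map_zero]
      exact (map_zero _).symm
    · intro s hs
      obtain ⟨h, e⟩ := decomposition_monomial K L s
      have hd : s.degree = n := by
        have := hp (mem_support_iff.1 hs)
        rwa [Finsupp.degree_eq_weight_one]
      subst hd
      have hc : Ideal.Quotient.mk (joinMeetIdeal K L) (monomial s (coeff s p)) =
          coeff s p • Ideal.Quotient.mk (joinMeetIdeal K L) (monomial s 1) := by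
        rw [← mul_one (coeff s p), ← smul_eq_mul, ← smul_monomial, smul_eq_mul, mul_one]
        rfl
      rw [hc]
      refine ⟨Submodule.smul_mem _ _ h, ?_⟩
      rw [map_smul, e]
      exact (DirectSum.lof K ℕ (fun n => grading K L n) s.degree).map_smul _ _ |>.symm
  exact key.2

noncomputable instance gradedAlgebra : GradedAlgebra (grading K L) := by
  refine GradedAlgebra.ofAlgHom _ (decomposition K L) ?_ ?_
  · apply Ideal.Quotient.algHom_ext
    ext a
    change DirectSum.coeAlgHom (grading K L) (decomposition K L (residue K a)) = residue K a
    rw [decomposition_residue, DirectSum.coeAlgHom_of]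
    rfl
  · rintro n ⟨_, p, hp, rfl⟩
    exact decomposition_mk K L hp

/-- The ideal of `H[L]` generated by the residue classes of the elements of a poset ideal `J`
of `L`, that is, of a (possibly empty) subset `J` such that `a ≤ b` and `b ∈ J` imply `a ∈ J`. -/
noncomputable def idealOfLowerSet (J : LowerSet L) : Ideal (JoinMeetAlgebra K L) :=
  Ideal.span (residue K '' (J : Set L))

/-- The set of all poset ideals of `H[L]`. -/
def posetIdeals : Set (Ideal (JoinMeetAlgebra K L)) :=
  Set.range (idealOfLowerSet K L)

end JoinMeetAlgebra

end JoinMeet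

/-!
The colon ideals decide everything. Suppose that a step of a filtration by poset ideals adds the
element `a` to a lower set `J`. In any lattice, the colon ideal of this step contains the classes of
the elements not above `a`, since `b * a = (b ⊔ a) * (b ⊓ a)` and `b ⊓ a < a` for such `b`; and no
class of an element above `a` belongs to it, by evaluation at the point where exactly the variables
above `a` take the value `1`.

If `L` is distributive, this is the whole colon ideal. By Birkhoff's theorem, `L` is a lattice of
finite sets, and sending an element to the monomial of its set defines a homomorphism into a
polynomial ring. Two monomials of `K[L]` with the same image are congruent
(`IsToricWeight.prod_residue_eq`): the join of all factors can be split off, it is determined by the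
support of the image, and one cancels it and inducts. Hence the kernel of the toric homomorphism that
kills the variables not above `a` is generated by these variables (`sub_toricSection_mem`). As its
target is a domain, `r * a ∈ (J)` forces `r` into this kernel (`mem_of_mul_residue_mem`).

Conversely, in a Koszul filtration of poset ideals every `a` is added at some step, because a cyclic
step adds at most one element (`eq_of_isPrincipal_map_mkQ`). The colon ideal of that step is a poset
ideal, hence generated by elements not above `a`, and it contains the annihilator of `a`
(`mem_of_mul_residue_eq_zero`). Straightening `x * y * z` in two ways gives
`i * m * o = i * m' * o`, where `o` and `i` are the meet and the join of `x`, `y`, `z`, and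
`m = (x ⊓ y) ⊔ ((x ⊔ y) ⊓ z)`, `m' = (y ⊓ z) ⊔ ((y ⊔ z) ⊓ x)`. So `i * (m - m')` annihilates `o` and
belongs to the ideal generated by the elements not above `o`. Products of comparable variables above
`o` are linearly independent modulo this ideal (`eq_of_mul_sub_mem`), so `m = m'`, an identity that makes a
lattice distributive (`isDistributive_of_median`).
-/

namespace JoinMeet

open MvPolynomial

/-! ### Homomorphisms out of `H[L]` and membership in poset ideals -/

section Homomorphisms

variable {K L : Type*} [Field K] [Lattice L]

theorem residue_mul_residue (a b : L) :
    residue K a * residue K b = residue K (a ⊔ b) * residue K (a ⊓ b) := by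
  by_cases hab : a ≤ b
  · rw [sup_eq_right.2 hab, inf_eq_left.2 hab, mul_comm]
  by_cases hba : b ≤ a
  · rw [sup_eq_left.2 hba, inf_eq_right.2 hba]
  simp only [residue, ← map_mul]
  exact Ideal.Quotient.eq.2 (Ideal.subset_span ⟨a, b, hab, hba, rfl⟩)

/-- The homomorphism out of `H[L]` with prescribed values `h a` on the residue classes of the
variables, where `h` satisfies the join-meet relations. -/
noncomputable def liftResidue {A : Type*} [CommRing A] [Algebra K A] (h : L → A)
    (hh : ∀ a b, h a * h b = h (a ⊔ b) * h (a ⊓ b)) : JoinMeetAlgebra K L →ₐ[K] A :=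
  Ideal.Quotient.liftₐ (joinMeetIdeal K L) (aeval h) (by
    intro p hp
    change p ∈ RingHom.ker _
    refine (Ideal.span_le.2 ?_ : joinMeetIdeal K L ≤ _) hp
    rintro _ ⟨a, b, -, -, rfl⟩
    simp [RingHom.mem_ker, hh a b])

@[simp]
theorem liftResidue_residue {A : Type*} [CommRing A] [Algebra K A] (h : L → A)
    (hh : ∀ a b, h a * h b = h (a ⊔ b) * h (a ⊓ b)) (a : L) :
    liftResidue (K := K) h hh (residue K a) = h a :=
  aeval_X _ a

theorem map_eq_zero_of_mem_idealOfLowerSet {A : Type*} [CommRing A] [Algebra K A]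
    (f : JoinMeetAlgebra K L →ₐ[K] A) {J : LowerSet L} (hJ : ∀ b ∈ J, f (residue K b) = 0)
    {x : JoinMeetAlgebra K L} (hx : x ∈ idealOfLowerSet K L J) : f x = 0 := by
  refine (Ideal.span_le.2 ?_ : idealOfLowerSet K L J ≤ RingHom.ker f) hx
  rintro _ ⟨b, hb, rfl⟩
  exact hJ b hb

theorem residue_mem_idealOfLowerSet {J : LowerSet L} {a : L} (h : a ∈ J) :
    residue K a ∈ idealOfLowerSet K L J :=
  Ideal.subset_span ⟨a, h, rfl⟩

/-- The elements not above `a` lie in the colon ideal of the step that adds `a`, in any lattice. -/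
theorem mul_residue_mem_idealOfLowerSet {J : LowerSet L} {a b : L} (hab : ¬ a ≤ b)
    (hJ : ∀ c, c < a → c ∈ J) : residue K b * residue K a ∈ idealOfLowerSet K L J := by
  rw [residue_mul_residue]
  exact Ideal.mul_mem_left _ _ (residue_mem_idealOfLowerSet
    (hJ _ (inf_le_right.lt_of_ne fun h => hab (inf_eq_right.1 h))))

open Classical in
/-- The point of the spectrum of `H[L]` at which the variables above `a` take the value `1` and the
other variables vanish. -/
noncomputable def evalIci (a : L) : JoinMeetAlgebra K L →ₐ[K] K :=
  liftResidue (fun b => if a ≤ b then 1 else 0) (by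
    intro b c
    by_cases hb : a ≤ b
    · by_cases hc : a ≤ c <;> simp [hb, hc, le_sup_of_le_left]
    · simp [hb])

theorem evalIci_residue_of_le {a b : L} (h : a ≤ b) : evalIci a (residue K b) = 1 := by
  simp [evalIci, h]

theorem evalIci_residue_of_not_le {a b : L} (h : ¬ a ≤ b) : evalIci a (residue K b) = 0 := by
  simp [evalIci, h]

theorem mem_of_residue_mul_residue_mem {J : LowerSet L} {a b : L} (hab : a ≤ b)
    (h : residue K b * residue K a ∈ idealOfLowerSet K L J) : a ∈ J := by
  by_contra ha
  have h0 := map_eq_zero_of_mem_idealOfLowerSet (evalIci a) (fun c hc =>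
    evalIci_residue_of_not_le fun hac => ha (J.lower hac hc)) h
  rw [map_mul, evalIci_residue_of_le hab, evalIci_residue_of_le le_rfl, mul_one] at h0
  exact one_ne_zero h0

@[simp]
theorem residue_mem_idealOfLowerSet_iff {J : LowerSet L} {a : L} :
    residue K a ∈ idealOfLowerSet K L J ↔ a ∈ J :=
  ⟨fun h => mem_of_residue_mul_residue_mem le_rfl (Ideal.mul_mem_left _ _ h),
    residue_mem_idealOfLowerSet⟩

theorem idealOfLowerSet_le_iff {J J' : LowerSet L} :
    idealOfLowerSet K L J ≤ idealOfLowerSet K L J' ↔ J ≤ J' := by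
  refine ⟨fun h a ha => residue_mem_idealOfLowerSet_iff.1 (h (residue_mem_idealOfLowerSet ha)),
    fun h => Ideal.span_mono (Set.image_mono h)⟩

theorem mem_colon_idealOfLowerSet_iff {I J : LowerSet L} {r : JoinMeetAlgebra K L} :
    r ∈ (idealOfLowerSet K L J).colon (idealOfLowerSet K L I : Set (JoinMeetAlgebra K L)) ↔
      ∀ c ∈ I, r * residue K c ∈ idealOfLowerSet K L J := by
  rw [idealOfLowerSet, idealOfLowerSet, Ideal.colon_span,
    Submodule.mem_colon, Set.forall_mem_image]
  rfl

theorem idealOfLowerSet_bot : idealOfLowerSet K L ⊥ = ⊥ := by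
  simp [idealOfLowerSet]

/-- The homomorphism from `H[L]` to the trivial square-zero extension `K ⊕ K^L` whose second
component reads off the linear part of an element. -/
noncomputable def linearPart : JoinMeetAlgebra K L →ₐ[K] TrivSqZeroExt K (L → K) := by
  classical
  exact liftResidue (fun b => TrivSqZeroExt.inr (Pi.single b 1)) (by simp)

theorem linearPart_residue [DecidableEq L] (a : L) :
    linearPart (residue K a) = TrivSqZeroExt.inr (Pi.single a 1) := by
  rw [linearPart, liftResidue_residue]
  congr!

theorem idealOfLowerSet_top :
    idealOfLowerSet K L ⊤ = (HomogeneousIdeal.irrelevant (grading K L)).toIdeal := by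
  apply le_antisymm
  · refine Ideal.span_le.2 ?_
    rintro _ ⟨a, -, rfl⟩
    exact HomogeneousIdeal.mem_irrelevant_of_mem _ one_pos (linearResidue K L a).2
  · rw [HomogeneousIdeal.toIdeal_irrelevant_le]
    rintro n hn _ ⟨p, hp, rfl⟩
    change Ideal.Quotient.mk _ p ∈ _
    rw [p.as_sum, map_sum]
    refine sum_mem fun s hs => ?_
    have hs0 : s ≠ 0 := by
      rintro rfl
      have := hp (mem_support_iff.1 hs)
      simp at this
      omega
    obtain ⟨a, ha⟩ := Finsupp.ne_iff.1 hs0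
    have hX : (X a : MvPolynomial L K) ∣ monomial s (coeff s p) :=
      X_dvd_monomial.2 (Or.inr (by simpa using ha))
    obtain ⟨q, hq⟩ := hX
    rw [hq, map_mul]
    exact Ideal.mul_mem_right _ _ (residue_mem_idealOfLowerSet (LowerSet.mem_top))

end Homomorphisms

/-! ### Annihilators of residue classes in the presence of a Koszul filtration -/

section Chain

variable {K L : Type*} [Field K] [Lattice L]

/-- If `I / J` is cyclic, then `I` has at most one generator outside `J`. The linear parts of two
further generators would be proportional. -/
theorem eq_of_isPrincipal_map_mkQ {I J : LowerSet L}
    (h : (Submodule.map (Submodule.mkQ (idealOfLowerSet K L J))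
      (idealOfLowerSet K L I)).IsPrincipal)
    {a c : L} (haI : a ∈ I) (haJ : a ∉ J) (hcI : c ∈ I) (hcJ : c ∉ J) : a = c := by
  classical
  by_contra hac
  obtain ⟨⟨g', hg'⟩⟩ := h
  have hgmem : g' ∈ Submodule.map (Submodule.mkQ (idealOfLowerSet K L J))
      (idealOfLowerSet K L I) := hg' ▸ Submodule.mem_span_singleton_self g'
  obtain ⟨g, hgI, rfl⟩ := hgmem
  have hg0 : (linearPart g).fst = 0 :=
    map_eq_zero_of_mem_idealOfLowerSet ((TrivSqZeroExt.fstHom K K (L → K)).comp linearPart)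
      (fun b _ => by simp [linearPart_residue]) hgI
  have key : ∀ b ∈ I, ∃ k : K, ∀ d ∉ J, (Pi.single b 1 : L → K) d = k * (linearPart g).snd d := by
    intro b hb
    have hbm : Submodule.mkQ (idealOfLowerSet K L J) (residue K b) ∈
        Submodule.map (Submodule.mkQ (idealOfLowerSet K L J)) (idealOfLowerSet K L I) :=
      Submodule.mem_map_of_mem (residue_mem_idealOfLowerSet hb)
    rw [hg', Submodule.mem_span_singleton] at hbm
    obtain ⟨r, hr⟩ := hbm
    rw [← map_smul, ← sub_eq_zero, ← map_sub, ← LinearMap.mem_ker, Submodule.ker_mkQ] at hr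
    refine ⟨(linearPart r).fst, fun d hd => ?_⟩
    have hlin : ∀ x ∈ idealOfLowerSet K L J, (linearPart x).fst = 0 ∧ (linearPart x).snd d = 0 := by
      intro x hx
      refine Submodule.span_induction (p := fun x _ =>
        (linearPart x).fst = 0 ∧ (linearPart x).snd d = 0) ?_ ?_ ?_ ?_ hx
      · rintro _ ⟨e, he, rfl⟩
        have : d ≠ e := fun h => hd (h ▸ he)
        simp [linearPart_residue, this]
      · simp
      · rintro x y - - ⟨hx, hx'⟩ ⟨hy, hy'⟩
        simp [hx, hx', hy, hy']
      · rintro r x - ⟨hx, hx'⟩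
        simp [hx, hx']
    have := (hlin _ hr).2
    simp [linearPart_residue, hg0, sub_eq_zero] at this
    exact this.symm
  obtain ⟨k, hk⟩ := key a haI
  obtain ⟨l, hl⟩ := key c hcI
  have h1 := hk a haJ
  have h2 := hk c hcJ
  have h3 := hl c hcJ
  rw [Pi.single_eq_same] at h1 h3
  rw [Pi.single_eq_of_ne (Ne.symm hac), eq_comm, mul_eq_zero] at h2
  rcases h2 with h2 | h2
  · simp [h2] at h1
  · simp [h2] at h3

/-- A Koszul filtration consisting of poset ideals adds every element `a` of `L` at some step, and
the colon ideal at that step is generated by elements that do not lie above `a`. Hence so is the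
annihilator of the residue class of `a`. -/
theorem mem_of_mul_residue_eq_zero [Finite L] {F : Set (Ideal (JoinMeetAlgebra K L))}
    (hF : IsKoszulFiltration (grading K L) F) (hFP : ∀ I ∈ F, I ∈ posetIdeals K L)
    {a : L} {r : JoinMeetAlgebra K L} (hr : r * residue K a = 0) :
    r ∈ idealOfLowerSet K L (UpperSet.Ici a).compl := by
  -- A minimal member of the filtration that contains the class of `a` is the one that adds it.
  have hne : {J : LowerSet L | idealOfLowerSet K L J ∈ F ∧ a ∈ J}.Nonempty :=
    ⟨⊤, by rw [idealOfLowerSet_top]; exact hF.maximal_mem, LowerSet.mem_top⟩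
  obtain ⟨I, ⟨hIF, haI⟩, hmin⟩ := (Set.toFinite _).exists_minimal hne
  have hI0 : idealOfLowerSet K L I ≠ ⊥ := by
    intro h
    rw [← idealOfLowerSet_bot] at h
    exact (idealOfLowerSet_le_iff.1 h.le haI).elim
  obtain ⟨J', hJ'F, hlt, hcyc, hcol⟩ := hF.exists_cyclic_step _ hIF hI0
  obtain ⟨J, rfl⟩ := hFP _ hJ'F
  obtain ⟨P, hP⟩ := hFP _ hcol
  have haJ : a ∉ J := fun h =>
    hlt.not_ge (idealOfLowerSet_le_iff.2 (hmin ⟨hJ'F, h⟩ (idealOfLowerSet_le_iff.1 hlt.le)))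
  have hrP : r ∈ idealOfLowerSet K L P := by
    rw [hP, mem_colon_idealOfLowerSet_iff]
    intro c hc
    by_cases hcJ : c ∈ J
    · exact Ideal.mul_mem_left _ _ (residue_mem_idealOfLowerSet hcJ)
    · rw [← eq_of_isPrincipal_map_mkQ hcyc haI haJ hc hcJ, hr]
      exact zero_mem _
  refine (idealOfLowerSet_le_iff (K := K)).2 (fun b hb => ?_) hrP
  have hb' := residue_mem_idealOfLowerSet (K := K) hb
  rw [hP, mem_colon_idealOfLowerSet_iff] at hb'
  exact fun hab => haJ (mem_of_residue_mul_residue_mem hab (hb' a haI))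

end Chain

/-! ### From annihilators to distributivity -/

section Distributivity

variable {K L : Type*} [Field K] [Lattice L]

open Classical in
/-- The linear functional on `K[L]` that takes the value `1` on the monomials `X b * X c` with
`b ⊔ c = i` and `b ⊓ c = m`, and vanishes on all other monomials. -/
noncomputable def pairFunctional (K : Type*) [Field K] (i m : L) : MvPolynomial L K →ₗ[K] K :=
  (basisMonomials L K).constr K fun s =>
    if s.degree = 2 ∧ IsLUB (s.support : Set L) i ∧ IsGLB (s.support : Set L) m then 1 else 0

open Classical in
theorem pairFunctional_monomial (i m : L) (s : L →₀ ℕ) :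
    pairFunctional K i m (monomial s 1) =
      if s.degree = 2 ∧ IsLUB (s.support : Set L) i ∧ IsGLB (s.support : Set L) m
        then 1 else 0 := by
  have := (basisMonomials L K).constr_basis K (fun s : L →₀ ℕ =>
    if s.degree = 2 ∧ IsLUB (s.support : Set L) i ∧ IsGLB (s.support : Set L) m
      then (1 : K) else 0) s
  simpa [pairFunctional] using this

open Classical in
theorem pairFunctional_X_mul_X (i m b c : L) :
    pairFunctional K i m (X b * X c) = if b ⊔ c = i ∧ b ⊓ c = m then 1 else 0 := by
  have hs : ((Finsupp.single b 1 + Finsupp.single c 1 : L →₀ ℕ).support : Set L) = {b, c} := by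
    ext d
    simp [Finsupp.single_apply]
    tauto
  rw [X, X, monomial_mul, one_mul, pairFunctional_monomial, hs]
  have h1 : IsLUB {b, c} i ↔ b ⊔ c = i := ⟨fun h => isLUB_pair.unique h, fun h => h ▸ isLUB_pair⟩
  have h2 : IsGLB {b, c} m ↔ b ⊓ c = m := ⟨fun h => isGLB_pair.unique h, fun h => h ▸ isGLB_pair⟩
  simp [h1, h2]

theorem pairFunctional_mul_eq_zero_of_mem_span {i m : L} {S : Set (MvPolynomial L K)}
    (hS : ∀ p ∈ S, ∀ u : L →₀ ℕ, pairFunctional K i m (monomial u 1 * p) = 0)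
    {p : MvPolynomial L K} (hp : p ∈ Ideal.span S) : pairFunctional K i m p = 0 := by
  suffices ∀ q, pairFunctional K i m (q * p) = 0 by simpa using this 1
  refine Submodule.span_induction
    (p := fun p _ => ∀ q, pairFunctional K i m (q * p) = 0) ?_ (by simp) ?_ ?_ hp
  · intro p hp q
    induction q using MvPolynomial.induction_on' with
    | monomial u c =>
      rw [show monomial u c = c • monomial u (1 : K) by rw [smul_monomial, smul_eq_mul, mul_one],
        smul_mul_assoc, map_smul, hS p hp, smul_zero]
    | add q q' hq hq' => rw [add_mul, map_add, hq, hq', add_zero]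
  · intro x y _ _ hx hy q
    rw [mul_add, map_add, hx, hy, add_zero]
  · intro r x _ hx q
    rw [smul_eq_mul, ← mul_assoc, hx]

theorem pairFunctional_eq_zero_of_degree_ne {i m : L} {s : L →₀ ℕ} (h : s.degree ≠ 2) :
    pairFunctional K i m (monomial s 1) = 0 := by
  classical simp [pairFunctional_monomial, h]

theorem pairFunctional_eq_zero_of_mem_joinMeetIdeal {i m : L} {p : MvPolynomial L K}
    (hp : p ∈ joinMeetIdeal K L) : pairFunctional K i m p = 0 := by
  classical
  refine pairFunctional_mul_eq_zero_of_mem_span ?_ hp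
  rintro _ ⟨a, b, -, -, rfl⟩ u
  rw [mul_sub, map_sub, sub_eq_zero]
  by_cases hu : u = 0
  · subst hu
    have h : (monomial (0 : L →₀ ℕ) (1 : K)) = 1 := rfl
    have h1 : a ⊔ b ⊔ a ⊓ b = a ⊔ b := sup_eq_left.2 (inf_le_left.trans le_sup_left)
    have h2 : (a ⊔ b) ⊓ (a ⊓ b) = a ⊓ b := inf_eq_right.2 (inf_le_left.trans le_sup_left)
    simp only [h, one_mul, pairFunctional_X_mul_X, h1, h2]
  · have hd : u.degree ≠ 0 := fun h => hu ((Finsupp.degree_eq_zero_iff u).1 h)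
    simp only [X, monomial_mul, one_mul]
    rw [pairFunctional_eq_zero_of_degree_ne, pairFunctional_eq_zero_of_degree_ne] <;>
      · simp only [map_add, Finsupp.degree_single]
        omega

/-- Since `m` lies below both factors of every monomial in the support of the functional, the latter
vanishes on all poset ideals that avoid `m`. -/
theorem pairFunctional_eq_zero_of_mk_mem {i m : L} {J : LowerSet L} (hm : m ∉ J)
    {p : MvPolynomial L K} (hp : Ideal.Quotient.mk _ p ∈ idealOfLowerSet K L J) :
    pairFunctional K i m p = 0 := by
  classical
  have hmap : idealOfLowerSet K L J =
      (Ideal.span (X '' (J : Set L))).map (Ideal.Quotient.mk (joinMeetIdeal K L)) := by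
    rw [Ideal.map_span, Set.image_image]
    rfl
  rw [hmap, Ideal.mem_map_iff_of_surjective _ Ideal.Quotient.mk_surjective] at hp
  obtain ⟨q, hq, hqp⟩ := hp
  have h1 := pairFunctional_eq_zero_of_mem_joinMeetIdeal (i := i) (m := m) (Ideal.Quotient.eq.1 hqp)
  have h2 : pairFunctional K i m q = 0 := by
    refine pairFunctional_mul_eq_zero_of_mem_span ?_ hq
    rintro _ ⟨b, hb, rfl⟩ u
    rw [X, monomial_mul, one_mul, pairFunctional_monomial, if_neg]
    rintro ⟨-, -, h⟩
    exact hm (J.lower (h.1 (by simp)) hb)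
  rw [map_sub, h2, zero_sub, neg_eq_zero] at h1
  exact h1

/-- The instance needed of the fact that the products of two comparable elements above `o` are
linearly independent modulo the variables that do not lie above `o`. -/
theorem eq_of_mul_sub_mem {o i m m' : L} (hom : o ≤ m) (hm : m ≤ i) (hm' : m' ≤ i)
    (h : residue K i * (residue K m - residue K m') ∈
      idealOfLowerSet K L (UpperSet.Ici o).compl) : m = m' := by
  classical
  have hmJ : m ∉ (UpperSet.Ici o).compl := fun h => h hom
  have h0 : pairFunctional K i m (X i * X m - X i * X m') = 0 := by
    refine pairFunctional_eq_zero_of_mk_mem hmJ ?_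
    rw [← mul_sub, map_mul, map_sub]
    exact h
  by_contra hne
  simp [pairFunctional_X_mul_X, hm, hm', Ne.symm hne] at h0

/-- Straightening turns the product of the classes of `x`, `y` and `z` into a product of a chain. The
left side is symmetric in `x`, `y`, `z`, the middle term on the right is not. -/
theorem residue_straighten (x y z : L) :
    residue K x * residue K y * residue K z =
      residue K (x ⊔ y ⊔ z) * residue K (x ⊓ y ⊔ (x ⊔ y) ⊓ z) * residue K (x ⊓ y ⊓ z) := by
  have h : x ⊓ y ⊓ ((x ⊔ y) ⊓ z) = x ⊓ y ⊓ z := by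
    rw [← inf_assoc, inf_eq_left.2 (inf_le_left.trans le_sup_left : x ⊓ y ≤ x ⊔ y)]
  calc residue K x * residue K y * residue K z
      = residue K (x ⊓ y) * (residue K (x ⊔ y) * residue K z) := by
        rw [residue_mul_residue x y]; ring
    _ = residue K (x ⊔ y ⊔ z) * (residue K (x ⊓ y) * residue K ((x ⊔ y) ⊓ z)) := by
        rw [residue_mul_residue (x ⊔ y) z]; ring
    _ = _ := by rw [residue_mul_residue (x ⊓ y), h]; ring

/-- For `x ≤ z` the identity is the modular law; given that law, the meets of both sides with `x` are
the two sides of the distributive law. -/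
theorem isDistributive_of_median (h : ∀ x y z : L, x ⊓ y ⊔ (x ⊔ y) ⊓ z = y ⊓ z ⊔ (y ⊔ z) ⊓ x) :
    IsDistributive L := by
  have hmod : ∀ x y z : L, x ≤ z → (x ⊔ y) ⊓ z = x ⊔ y ⊓ z := by
    intro x y z hxz
    have := h x y z
    rw [sup_eq_right.2 (le_inf (inf_le_left.trans le_sup_left) (inf_le_left.trans hxz)),
      inf_eq_right.2 (hxz.trans le_sup_right), sup_comm (y ⊓ z)] at this
    exact this
  have hd : ∀ x y z : L, x ⊓ (y ⊔ z) = x ⊓ y ⊔ x ⊓ z := by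
    intro x y z
    have h1 : (x ⊓ y ⊔ (x ⊔ y) ⊓ z) ⊓ x = x ⊓ y ⊔ x ⊓ z := by
      rw [hmod _ _ _ inf_le_left, inf_right_comm, inf_comm (x ⊔ y), inf_sup_self]
    have h2 : (y ⊓ z ⊔ (y ⊔ z) ⊓ x) ⊓ x = x ⊓ (y ⊔ z) := by
      rw [sup_comm, hmod _ _ _ inf_le_right, sup_eq_left.2, inf_comm]
      exact inf_le_inf_right x (inf_le_left.trans le_sup_left)
    rw [← h1, ← h2, h x y z]
  let _ := DistribLattice.ofInfSupLe fun x y z : L => (hd x y z).le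
  exact fun x y z => ⟨hd x y z, sup_inf_left x y z⟩

theorem isDistributive_of_isKoszulFiltration [Finite L] {F : Set (Ideal (JoinMeetAlgebra K L))}
    (hF : IsKoszulFiltration (grading K L) F) (hFP : ∀ I ∈ F, I ∈ posetIdeals K L) :
    IsDistributive L := by
  refine isDistributive_of_median fun x y z => ?_
  have h1 := residue_straighten (K := K) x y z
  have h2 := residue_straighten (K := K) y z x
  rw [show y ⊔ z ⊔ x = x ⊔ y ⊔ z by ac_rfl, show y ⊓ z ⊓ x = x ⊓ y ⊓ z by ac_rfl] at h2
  refine eq_of_mul_sub_mem (K := K) (o := x ⊓ y ⊓ z) (i := x ⊔ y ⊔ z)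
    (inf_le_left.trans le_sup_left)
    (sup_le (inf_le_left.trans (le_sup_left.trans le_sup_left)) (inf_le_left.trans le_sup_left))
    (sup_le (inf_le_right.trans le_sup_right)
      (inf_le_right.trans (le_sup_left.trans le_sup_left)))
    (mem_of_mul_residue_eq_zero hF hFP ?_)
  -- Both products become the class of `x * y * z` after multiplication by the class of the meet.
  rw [mul_sub, sub_mul, ← h1, ← h2]
  ring

end Distributivity

/-! ### The toric representation for a distributive lattice -/

section Toric

variable {L : Type*} [Lattice L]

/-- An assignment of exponent vectors to the elements of a lattice that satisfies the join-meet
relations, and in which the supports are nonempty, separate the elements and turn joins into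
unions. -/
structure IsToricWeight {γ : Type*} (w : L → γ →₀ ℕ) : Prop where
  add_eq : ∀ a b, w a + w b = w (a ⊔ b) + w (a ⊓ b)
  mem_support_sup : ∀ a b p, p ∈ (w (a ⊔ b)).support ↔ p ∈ (w a).support ∨ p ∈ (w b).support
  eq_of_support_eq : ∀ a b, (w a).support = (w b).support → a = b
  ne_zero : ∀ a, w a ≠ 0

/-- A finite distributive lattice has a toric weight: by Birkhoff's theorem it is a lattice of
finite sets, and an element is sent to the indicator of its set, enlarged by a common point. -/
theorem exists_isToricWeight.{u} {L : Type u} [Lattice L] [Finite L] (hL : IsDistributive L) :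
    ∃ (γ : Type u) (w : L → γ →₀ ℕ), IsToricWeight w := by
  let _ : DistribLattice L := DistribLattice.ofInfSupLe fun x y z => (hL x y z).1.le
  obtain ⟨β, _, _, f, hf⟩ := exists_birkhoff_representation L
  have hsupp : ∀ a, (Multiset.toFinsupp (Finset.insertNone (f a)).val).support =
      Finset.insertNone (f a) := fun a => by simp
  refine ⟨Option β, fun a => Multiset.toFinsupp (Finset.insertNone (f a)).val, ?_, ?_, ?_, ?_⟩
  · intro a b
    rw [← map_add, ← map_add, ← Multiset.union_add_inter, ← Finset.union_val, ← Finset.inter_val]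
    congr 4
    · ext p; cases p <;> simp
    · ext p; cases p <;> simp
  · intro a b p
    rw [hsupp, hsupp, hsupp]
    cases p <;> simp
  · intro a b h
    rw [hsupp, hsupp] at h
    exact hf (Finset.insertNone.injective h)
  · intro a h
    have := hsupp a
    rw [h] at this
    have hn : (none : Option β) ∈ Finset.insertNone (f a) := by simp
    rw [← this] at hn
    simp at hn

variable {K : Type*} [Field K] {γ : Type*} {w : L → γ →₀ ℕ}

/-- The join of all factors can be split off from a nonempty product of residue classes; it is
determined by the support of the weight of the product. -/
theorem IsToricWeight.exists_split (hw : IsToricWeight w) (s : Multiset L) :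
    ∀ a, ∃ (m : L) (s' : Multiset L), s'.card = s.card ∧
      ((a ::ₘ s).map (residue K)).prod = residue K m * (s'.map (residue K)).prod ∧
      ((a ::ₘ s).map w).sum = w m + (s'.map w).sum ∧
      ∀ p, p ∈ ((a ::ₘ s).map w).sum.support ↔ p ∈ (w m).support := by
  induction s using Multiset.induction with
  | empty => exact fun a => ⟨a, 0, rfl, by simp, by simp, by simp⟩
  | cons b s ih =>
    intro a
    obtain ⟨m, s', hcard, hprod, hsum, hsupp⟩ := ih b
    refine ⟨a ⊔ m, (a ⊓ m) ::ₘ s', by simp [hcard], ?_, ?_, ?_⟩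
    · rw [Multiset.map_cons, Multiset.prod_cons, hprod, ← mul_assoc, residue_mul_residue]
      simp [mul_assoc]
    · rw [Multiset.map_cons, Multiset.sum_cons, hsum, ← add_assoc, hw.add_eq]
      simp [add_assoc]
    · intro p
      rw [hw.mem_support_sup, ← hsupp, Multiset.map_cons, Multiset.sum_cons]
      simp only [Finsupp.mem_support_iff, Finsupp.add_apply]
      omega

theorem IsToricWeight.sum_cons_ne_zero (hw : IsToricWeight w) (a : L) (s : Multiset L) :
    ((a ::ₘ s).map w).sum ≠ 0 := by
  rw [Multiset.map_cons, Multiset.sum_cons]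
  exact fun h => hw.ne_zero a (add_eq_zero.1 h).1

/-- Monomials of the same weight have the same class in `H[L]`: their joins agree, and can be
cancelled from the weights. -/
theorem IsToricWeight.prod_residue_eq (hw : IsToricWeight w) {s t : Multiset L}
    (h : (s.map w).sum = (t.map w).sum) :
    (s.map (residue K)).prod = (t.map (residue K)).prod := by
  induction hn : s.card generalizing s t with
  | zero =>
    obtain rfl := Multiset.card_eq_zero.1 hn
    induction t using Multiset.induction with
    | empty => rfl
    | cons b t => exact (hw.sum_cons_ne_zero b t (by simpa using h.symm)).elim
  | succ n ih =>
    induction s using Multiset.induction with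
    | empty => simp at hn
    | cons a s =>
      induction t using Multiset.induction with
      | empty => exact (hw.sum_cons_ne_zero a s (by simpa using h)).elim
      | cons b t =>
        obtain ⟨m, s', hcard, hprod, hsum, hsupp⟩ := hw.exists_split (K := K) s a
        obtain ⟨m', t', -, hprod', hsum', hsupp'⟩ := hw.exists_split (K := K) t b
        obtain rfl : m = m' := hw.eq_of_support_eq _ _ (Finset.ext fun p => by
          rw [← hsupp, ← hsupp', h])
        rw [hsum, hsum', add_right_inj] at h
        rw [Multiset.card_cons] at hn
        rw [hprod, hprod', ih h (by omega)]

open Classical in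
/-- The toric homomorphism that kills the variables not above `a`. -/
noncomputable def toricHom (K : Type*) [Field K] {w : L → γ →₀ ℕ} (hw : IsToricWeight w) (a : L) :
    JoinMeetAlgebra K L →ₐ[K] MvPolynomial γ K :=
  liftResidue (fun b => if a ≤ b then monomial (w b) 1 else 0) (by
    intro b c
    by_cases hb : a ≤ b
    · by_cases hc : a ≤ c <;> simp [hb, hc, le_sup_of_le_left, monomial_mul, hw.add_eq]
    · simp [hb])

theorem toricHom_residue_of_le (hw : IsToricWeight w) {a b : L} (h : a ≤ b) :
    toricHom K hw a (residue K b) = monomial (w b) 1 := by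
  simp [toricHom, h]

theorem toricHom_residue_of_not_le (hw : IsToricWeight w) {a b : L} (h : ¬ a ≤ b) :
    toricHom K hw a (residue K b) = 0 := by
  simp [toricHom, h]

theorem toricHom_prod_residue (hw : IsToricWeight w) {a : L} {s : Multiset L}
    (h : ∀ b ∈ s, a ≤ b) :
    toricHom K hw a (s.map (residue K)).prod = monomial (s.map w).sum 1 := by
  induction s using Multiset.induction with
  | empty => simp
  | cons b s ih =>
    rw [Multiset.map_cons, Multiset.prod_cons, map_mul, ih fun c hc => h c (by simp [hc]),
      toricHom_residue_of_le hw (h b (by simp)), monomial_mul, Multiset.map_cons,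
      Multiset.sum_cons, one_mul]

theorem mk_monomial (s : L →₀ ℕ) (c : K) :
    Ideal.Quotient.mk (joinMeetIdeal K L) (monomial s c) =
      c • ((Finsupp.toMultiset s).map (residue K)).prod := by
  have h : monomial s c = c • ((Finsupp.toMultiset s).map (X : L → MvPolynomial L K)).prod := by
    rw [monomial_eq, Finsupp.toMultiset_map, Finsupp.prod_toMultiset,
      Finsupp.prod_mapDomain_index (by simp) (by simp [pow_add]), smul_eq_C_mul]
  rw [h, ← Ideal.Quotient.mkₐ_eq_mk K, map_smul, map_multiset_prod, Multiset.map_map]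
  rfl

open Classical in
/-- A linear section of the toric homomorphism modulo the variables not above `a`: a monomial of
the weight of some product of variables above `a` is sent to the class of one such product, any
other monomial to `0`. -/
noncomputable def toricSection (K : Type*) [Field K] (w : L → γ →₀ ℕ) (a : L) :
    MvPolynomial γ K →ₗ[K] JoinMeetAlgebra K L :=
  (basisMonomials γ K).constr K fun u =>
    if h : ∃ s : Multiset L, (∀ b ∈ s, a ≤ b) ∧ (s.map w).sum = u
      then (h.choose.map (residue K)).prod else 0

theorem toricSection_monomial (hw : IsToricWeight w) {a : L} {s : Multiset L}
    (hs : ∀ b ∈ s, a ≤ b) :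
    toricSection K w a (monomial (s.map w).sum 1) = (s.map (residue K)).prod := by
  classical
  have h : ∃ t : Multiset L, (∀ b ∈ t, a ≤ b) ∧ (t.map w).sum = (s.map w).sum := ⟨s, hs, rfl⟩
  have hc := (basisMonomials γ K).constr_basis K (fun u =>
    if h : ∃ s : Multiset L, (∀ b ∈ s, a ≤ b) ∧ (s.map w).sum = u
      then (h.choose.map (residue K)).prod else (0 : JoinMeetAlgebra K L)) (s.map w).sum
  rw [coe_basisMonomials] at hc
  refine hc.trans ?_
  rw [dif_pos h]
  exact hw.prod_residue_eq h.choose_spec.2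

/-- The kernel of the toric homomorphism consists of elements of the ideal generated by the variables
not above `a`. -/
theorem sub_toricSection_mem (hw : IsToricWeight w) (a : L) (r : JoinMeetAlgebra K L) :
    r - toricSection K w a (toricHom K hw a r) ∈
      idealOfLowerSet K L (UpperSet.Ici a).compl := by
  obtain ⟨p, rfl⟩ := Ideal.Quotient.mk_surjective r
  induction p using MvPolynomial.induction_on' with
  | monomial s c =>
    rw [mk_monomial, map_smul, map_smul, ← smul_sub]
    refine Submodule.smul_of_tower_mem _ c ?_
    by_cases hs : ∀ b ∈ Finsupp.toMultiset s, a ≤ b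
    · rw [toricHom_prod_residue hw hs, toricSection_monomial hw hs, sub_self]
      exact zero_mem _
    · push Not at hs
      obtain ⟨b, hb, hab⟩ := hs
      obtain ⟨t, ht⟩ := Multiset.exists_cons_of_mem hb
      rw [ht, Multiset.map_cons, Multiset.prod_cons, map_mul, toricHom_residue_of_not_le hw hab,
        zero_mul, map_zero, sub_zero]
      exact Ideal.mul_mem_right _ _ (residue_mem_idealOfLowerSet hab)
  | add p q hp hq =>
    rw [map_add, map_add, map_add, add_sub_add_comm]
    exact add_mem hp hq

/-- Modulo the variables not above `a`, the class of `a` is not a zero divisor. -/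
theorem mem_of_mul_residue_mem (hw : IsToricWeight w) {J : LowerSet L} {a : L} (ha : a ∉ J)
    {r : JoinMeetAlgebra K L} (h : r * residue K a ∈ idealOfLowerSet K L J) :
    r ∈ idealOfLowerSet K L (UpperSet.Ici a).compl := by
  have h0 := map_eq_zero_of_mem_idealOfLowerSet (toricHom K hw a) (fun b hb =>
    toricHom_residue_of_not_le hw fun hab => ha (J.lower hab hb)) h
  rw [map_mul, toricHom_residue_of_le hw le_rfl, mul_eq_zero, monomial_eq_zero] at h0
  have hr := sub_toricSection_mem hw a r
  rwa [h0.resolve_right one_ne_zero, map_zero, sub_zero] at hr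

end Toric

/-! ### The filtration by poset ideals -/

/-- The steps remove a maximal element `a` from a lower set; the colon ideal is then generated by
the elements that do not lie above `a`. -/
theorem isKoszulFiltration_posetIdeals {K L : Type*} [Field K] [Lattice L] [Finite L]
    (hL : IsDistributive L) : IsKoszulFiltration (grading K L) (posetIdeals K L) where
  generated_by_linear_forms := by
    rintro _ ⟨J, rfl⟩
    refine ⟨_, ?_, rfl⟩
    rintro _ ⟨a, -, rfl⟩
    exact (linearResidue K L a).2
  bot_mem := ⟨⊥, idealOfLowerSet_bot⟩
  maximal_mem := ⟨⊤, idealOfLowerSet_top⟩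
  exists_cyclic_step := by
    rintro _ ⟨I, rfl⟩ hI
    obtain ⟨γ, w, hw⟩ := exists_isToricWeight hL
    have hne : (I : Set L).Nonempty := by
      rw [Set.nonempty_iff_ne_empty]
      intro h
      exact hI (by rw [idealOfLowerSet, h, Set.image_empty, Ideal.span_empty])
    obtain ⟨a, ha, hmax⟩ := (Set.toFinite (I : Set L)).exists_maximal hne
    have haJ : a ∉ I.erase a := fun h => h.2 le_rfl
    have hIJ : ∀ b ∈ I, b = a ∨ b ∈ I.erase a := by
      intro b hb
      by_cases hab : a ≤ b
      · exact Or.inl (le_antisymm (hmax hb hab) hab)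
      · exact Or.inr ⟨hb, hab⟩
    have hle : idealOfLowerSet K L (I.erase a) ≤ idealOfLowerSet K L I :=
      idealOfLowerSet_le_iff.2 fun b hb => hb.1
    refine ⟨idealOfLowerSet K L (I.erase a), ⟨_, rfl⟩, ?_, ?_, ⟨(UpperSet.Ici a).compl, ?_⟩⟩
    · exact lt_of_le_not_ge hle fun h => haJ (idealOfLowerSet_le_iff.1 h ha)
    · refine ⟨⟨Submodule.mkQ _ (residue K a), le_antisymm ?_ ?_⟩⟩
      · refine Submodule.map_le_iff_le_comap.2 (Ideal.span_le.2 ?_)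
        rintro _ ⟨b, hb, rfl⟩
        rw [SetLike.mem_coe, Submodule.mem_comap]
        rcases hIJ b hb with rfl | hb
        · exact Submodule.mem_span_singleton_self _
        · have h0 : Submodule.mkQ (idealOfLowerSet K L (I.erase a)) (residue K b) = 0 :=
            (Submodule.Quotient.mk_eq_zero _).2 (residue_mem_idealOfLowerSet hb)
          rw [h0]
          exact zero_mem _
      · rw [Submodule.span_singleton_le_iff_mem]
        exact Submodule.mem_map_of_mem (residue_mem_idealOfLowerSet ha)
    · apply le_antisymm
      · refine Ideal.span_le.2 ?_
        rintro _ ⟨b, hab, rfl⟩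
        refine mem_colon_idealOfLowerSet_iff.2 fun c hc => ?_
        rcases hIJ c hc with rfl | hc
        · exact mul_residue_mem_idealOfLowerSet hab fun d hd => ⟨I.lower hd.le ha, hd.not_ge⟩
        · exact Ideal.mul_mem_left _ _ (residue_mem_idealOfLowerSet hc)
      · intro r hr
        exact mem_of_mul_residue_mem hw haJ (mem_colon_idealOfLowerSet_iff.1 hr a ha)

end JoinMeet

theorem theorem2p1 (K : Type*) [Field K] (L : Type*) [Lattice L] [Finite L] :
    List.TFAE [
      JoinMeet.IsDistributive L,
      JoinMeet.IsKoszulFiltration (JoinMeet.grading K L) (JoinMeet.posetIdeals K L),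
      ∃ F : Set (Ideal (JoinMeet.JoinMeetAlgebra K L)),
        JoinMeet.IsKoszulFiltration (JoinMeet.grading K L) F ∧
          ∀ I ∈ F, I ∈ JoinMeet.posetIdeals K L] := by
  tfae_have 1 → 2 := JoinMeet.isKoszulFiltration_posetIdeals
  tfae_have 2 → 3 := fun h => ⟨_, h, fun _ hI => hI⟩
  tfae_have 3 → 1 := fun ⟨_, hF, hFP⟩ => JoinMeet.isDistributive_of_isKoszulFiltration hF hFP
  tfae_finish
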